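/- Call an object of a category connected if it is not initial and is not a coproduct of two non-initial objects, and say that an object has power $\alpha$ (a cardinal) if it is a coproduct of $\alpha$ connected objects. A (locally small) category $\mathcal K$ is said to have width $w(\mathcal K)$ if it has coproducts, every object is a coproduct of (a set of) connected objects, and $w(\mathcal K)$ is the smallest cardinal such that (a) $\mathcal K$ has at most $w(\mathcal K)$ connected objects up to isomorphism, and (b) for every cardinal $\alpha\ge w(\mathcal K)$ there are at most $\alpha$ morphisms from a connected object to an object of power $\alpha$. For an infinite cardinal $\lambda>w(\mathcal K)$ let $\mathcal K_{\le\lambda}$ be the full subcategory of $\mathcal K$ on the objects that have power $\alpha$ for some $\alpha\le\lambda$. Theorem. Assume the Generalized Continuum Hypothesis ($2^{\mu}=\mu^{+}$ for every infinite cardinal $\mu$). Let $\mathcal K$ be a cocomplete and cowellpowered category that has width $w(\mathcal K)$. Then for every uncountable regular cardinal $\lambda>w(\mathcal K)$ the category $\mathcal K_{\le\lambda}$ is algebraically cocomplete, i.e. every endofunctor $F$ of $\mathcal K_{\le\lambda}$ has a terminal coalgebra. -/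

import Mathlib

open CategoryTheory CategoryTheory.Limits

universe v u

/-- The Generalized Continuum Hypothesis: for every infinite cardinal `c` the next larger
cardinal is `2 ^ c`. -/
def GCH : Prop :=
  ∀ c : Cardinal.{v}, Cardinal.aleph0 ≤ c → Order.succ c = 2 ^ c

section Power

variable {C : Type u} [Category.{v} C]

/-- An object is connected if it is not initial and is not a coproduct of two non-initial
objects: in every coproduct decomposition `X = A + B` one of the summands is initial. -/
def IsConnectedObject (X : C) : Prop :=
  IsEmpty (IsInitial X) ∧
    ∀ (A B : C) (f : A ⟶ X) (g : B ⟶ X), Nonempty (IsColimit (BinaryCofan.mk f g)) →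
      Nonempty (IsInitial A) ∨ Nonempty (IsInitial B)

/-- `X` has power `α` if it is a coproduct of `α` connected objects. -/
def HasPower (X : C) (α : Cardinal.{v}) : Prop :=
  ∃ (ι : Type v) (Y : ι → C) (inj : ∀ i, Y i ⟶ X),
    Cardinal.mk ι = α ∧ (∀ i, IsConnectedObject (Y i)) ∧
      Nonempty (IsColimit (Cofan.mk X inj))

end Power

section Width

variable (C : Type u) [Category.{v} C]

/-- The set of isomorphism classes of connected objects of `C`. -/
def connectedClasses : Set (Quotient (isIsomorphicSetoid C)) :=
  {c | ∃ X : C, IsConnectedObject X ∧ Quotient.mk (isIsomorphicSetoid C) X = c}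

/-- The two bounds in the definition of width: there are at most `w` connected objects up to
isomorphism, and for every `α ≥ w` there are at most `α` morphisms from a connected object to
an object of power `α`. -/
def IsWidthBound (w : Cardinal.{v}) : Prop :=
  Cardinal.lift.{v} (Cardinal.mk (connectedClasses C)) ≤ Cardinal.lift.{u} w ∧
    ∀ α : Cardinal.{v}, w ≤ α → ∀ B X : C, IsConnectedObject B → HasPower X α →
      Cardinal.mk (B ⟶ X) ≤ α

/-- `C` has width `w`: it has (small) coproducts, every object is a coproduct of connected
objects, and `w` is the smallest cardinal satisfying the two bounds. -/
def HasWidth (w : Cardinal.{v}) : Prop :=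
  HasCoproducts.{v} C ∧ (∀ X : C, ∃ α : Cardinal.{v}, HasPower X α) ∧
    IsLeast {k : Cardinal.{v} | IsWidthBound C k} w

/-- The objects of power at most `k`; the corresponding full subcategory is
`(powerLE C k).FullSubcategory`. -/
def powerLE (k : Cardinal.{v}) : ObjectProperty C :=
  fun X => ∃ α : Cardinal.{v}, α ≤ k ∧ HasPower X α

/-- Cowellpowered: every object has only a (small) set of quotients, that is, of epimorphisms
out of it up to isomorphism; these are the subobjects in the opposite category. -/
def IsCowellPowered : Prop :=
  WellPowered.{v} Cᵒᵖ

/-- Algebraically cocomplete: every endofunctor has a terminal coalgebra. -/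
def AlgebraicallyCocomplete : Prop :=
  ∀ F : C ⥤ C, HasTerminal (Endofunctor.Coalgebra F)

end Width

/-!
Let `A` be a coalgebra on a coproduct of at most `k` connected objects. A pigeonhole argument over
`2 ^ k` almost disjoint injections of the index set shows that every morphism from a connected
object to `F A` factors through `F` of a subcoproduct with fewer than `k` summands. Closing up
`ω` times, which is where `ℵ₀ < k` enters, such subcoproducts carry subcoalgebras, so the
coalgebras with fewer than `k` summands are dense. Since `k ^ c ≤ k` for `c < k`, there are at most
`k` of them up to isomorphism, and the colimit of a dense small subcategory is terminal.

That `powerLE C k` is closed under colimits of size at most `k` reduces to quotients: a quotient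
with more than `k` summands that each have two distinct morphisms to it would have at least
`μ ^ k⁺` morphisms to the coproduct of `μ` copies of all its summands, while the original object
has at most `μ ^ k`. This is absurd for `μ = ℶ_o` with `o` of cofinality `k⁺`, as then
`μ ^ k = μ < μ ^ k⁺`.
-/

namespace AlgebraicallyCocomplete

section Cardinals

open Cardinal

variable {k : Cardinal.{v}}

theorem mk_sigma_le (hk : ℵ₀ ≤ k) {ι : Type v} {S : ι → Type v} (hι : #ι ≤ k)
    (hS : ∀ i, #(S i) ≤ k) : #(Σ i, S i) ≤ k :=
  calc #(Σ i, S i) = sum fun i => #(S i) := mk_sigma _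
    _ ≤ sum fun _ : ι => k := sum_le_sum _ _ hS
    _ = #ι * k := sum_const' ι k
    _ ≤ k := mul_le_of_le hk hι le_rfl

theorem mk_Iio_ord_lt (i : k.ord.ToType) : #(Set.Iio i) < k := by
  simpa only [mk_ord_toType] using mk_Iio_lt i (by simp only [mk_ord_toType, Ordinal.type_toType])

theorem exists_forall_lt_of_lt_cof {c : Cardinal.{v}} (hc : c < k.ord.cof)
    (f : c.out → k.ord.ToType) : ∃ i, ∀ x, f x < i := by
  have hf : ¬ IsCofinal (Set.range f) := fun h =>
    ((Order.cof_le h).trans (mk_range_le.trans_eq c.mk_out)).not_gt (by rwa [Ordinal.cof_toType])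
  simpa only [Set.forall_mem_range] using not_isCofinal_iff.1 hf

theorem power_le_self_of_lt_cof (hk : ℵ₀ ≤ k) (h2 : 2 ^< k ≤ k) {c : Cardinal.{v}}
    (hc : c < k.ord.cof) : k ^ c ≤ k := by
  have hbounded : Function.Surjective
      fun p : Σ i : k.ord.ToType, c.out → Set.Iio i => fun x => (p.2 x : k.ord.ToType) := by
    intro f
    obtain ⟨i, hi⟩ := exists_forall_lt_of_lt_cof hc f
    exact ⟨⟨i, fun x => ⟨f x, hi x⟩⟩, rfl⟩
  have hfibre (i : k.ord.ToType) : #(c.out → Set.Iio i) ≤ k :=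
    calc #(c.out → Set.Iio i) = #(Set.Iio i) ^ c := by rw [← power_def, mk_out]
      _ ≤ (2 ^ #(Set.Iio i)) ^ c := power_le_power_right (cantor _).le
      _ = 2 ^ (#(Set.Iio i) * c) := power_mul.symm
      _ ≤ 2 ^< k := le_powerlt 2
        (mul_lt_of_lt hk (mk_Iio_ord_lt i) (hc.trans_le (Ordinal.cof_ord_le k)))
      _ ≤ k := h2
  calc k ^ c = #(c.out → k.ord.ToType) := by rw [← power_def, mk_ord_toType, mk_out]
    _ ≤ #(Σ i : k.ord.ToType, c.out → Set.Iio i) := mk_le_of_surjective hbounded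
    _ ≤ k := mk_sigma_le hk (mk_ord_toType k).le hfibre

theorem exists_ge_power_le_self_lt_power_succ (hk : ℵ₀ ≤ k) (ν : Cardinal.{v}) :
    ∃ μ, ν ≤ μ ∧ k ≤ μ ∧ μ ^ k ≤ μ ∧ μ < μ ^ Order.succ k := by
  let o : Ordinal.{v} := ν.ord + (Order.succ k).ord
  have hsucc : (Order.succ k).IsRegular := isRegular_succ hk
  have ho : Order.IsSuccLimit o :=
    Ordinal.isSuccLimit_add _ (isSuccLimit_ord hsucc.aleph0_le)
  have hcof : (ℶ_ o).ord.cof = Order.succ k :=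
    calc (ℶ_ o).ord.cof = o.cof :=
          Ordinal.cof_map_of_isNormal (isNormal_ord.comp isNormal_beth) ho
      _ = (Order.succ k).ord.cof := Ordinal.cof_add _ (ord_eq_zero.not.2 hsucc.pos.ne')
      _ = Order.succ k := hsucc.cof_ord
  have hstrong : 2 ^< ℶ_ o ≤ ℶ_ o :=
    powerlt_le.2 fun x hx => ((isStrongLimit_beth.2 ho.isSuccPrelimit).isStrongPrelimit hx).le
  refine ⟨ℶ_ o, (le_beth_ord ν).trans (beth_mono le_self_add), ?_,
    power_le_self_of_lt_cof (aleph0_le_beth o) hstrong (hcof ▸ Order.lt_succ k), ?_⟩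
  · exact (Order.le_succ k).trans ((le_beth_ord _).trans (beth_mono le_add_self))
  · simpa only [hcof] using lt_power_cof_ord (aleph0_le_beth o)

-- A set `A` of ordinals below `k` gives the injection sending `x` to (a code of) `A ∩ x`.
theorem exists_almost_disjoint_injections (hk : ℵ₀ ≤ k) (h2 : 2 ^< k ≤ k) {S : Type v}
    (hS : #S = k) : ∃ s : Set k.ord.ToType → S → S, (∀ A, Function.Injective (s A)) ∧
      Pairwise fun A B => #↥(Set.range (s A) ∩ Set.range (s B)) < k := by
  obtain ⟨e⟩ : Nonempty (S ≃ k.ord.ToType) := Cardinal.eq.1 (by rw [hS, mk_ord_toType])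
  obtain ⟨code⟩ : #(Σ i : k.ord.ToType, Set (Set.Iio i)) ≤ #S := by
    rw [hS]
    refine mk_sigma_le hk (mk_ord_toType k).le fun i => ?_
    rw [mk_set]
    exact (le_powerlt 2 (mk_Iio_ord_lt i)).trans h2
  refine ⟨fun A x => code ⟨e x, Subtype.val ⁻¹' A⟩, fun A x y hxy => e.injective
    (congrArg Sigma.fst (code.injective hxy)), fun A B hAB => ?_⟩
  obtain ⟨j, hj⟩ : ∃ j, ¬(j ∈ A ↔ j ∈ B) := by
    simpa only [not_forall] using mt Set.ext hAB
  have hsub : (Set.range fun x => code ⟨e x, Subtype.val ⁻¹' A⟩) ∩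
      (Set.range fun x => code ⟨e x, Subtype.val ⁻¹' B⟩) ⊆
        (fun i => code ⟨i, Subtype.val ⁻¹' A⟩) '' Set.Iic j := by
    rintro _ ⟨⟨x, rfl⟩, ⟨y, hy⟩⟩
    obtain ⟨hxy, htrace⟩ := Sigma.mk.inj_iff.1 (code.injective hy)
    obtain rfl := e.injective hxy
    refine ⟨e y, Set.mem_Iic.2 (not_lt.1 fun hjy => hj ?_), rfl⟩
    exact (Set.ext_iff.1 (eq_of_heq htrace) ⟨j, hjy⟩).symm
  refine (mk_le_mk_of_subset hsub).trans_lt (mk_image_le.trans_lt ?_)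
  rw [← Set.Iio_insert]
  exact mk_insert_le.trans_lt (add_lt_of_lt hk (mk_Iio_ord_lt j) (one_lt_aleph0.trans_le hk))

theorem exists_leftInverse_small_range (hk : ℵ₀ ≤ k) (h2 : 2 ^< k ≤ k) {S : Type v}
    (hS : #S ≤ k) : ∃ s r : Set k.ord.ToType → S → S, (∀ A, Function.LeftInverse (r A) (s A)) ∧
      Pairwise fun A B => #(Set.range (r A ∘ s B)) < k := by
  rcases hS.lt_or_eq with hlt | heq
  · exact ⟨fun _ => id, fun _ => id, fun _ _ => rfl, fun _ _ _ => mk_range_le.trans_lt hlt⟩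
  obtain ⟨s, hs, hdisj⟩ := exists_almost_disjoint_injections hk h2 heq
  have hS0 : Nonempty S := mk_ne_zero_iff.1 (heq ▸ (aleph0_pos.trans_le hk).ne')
  refine ⟨s, fun A => Function.invFun (s A), fun A => Function.leftInverse_invFun (hs A),
    fun A B hAB => ?_⟩
  have hsub : Set.range (Function.invFun (s A) ∘ s B) ⊆ insert (Classical.arbitrary S)
      (Function.invFun (s A) '' (Set.range (s A) ∩ Set.range (s B))) := by
    rintro _ ⟨x, rfl⟩
    by_cases hx : ∃ y, s A y = s B x
    · exact Or.inr ⟨s B x, ⟨hx, x, rfl⟩, rfl⟩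
    · exact Or.inl (Function.invFun_neg hx)
  exact (mk_le_mk_of_subset hsub).trans_lt (mk_insert_le.trans_lt
    (add_lt_of_lt hk (mk_image_le.trans_lt (hdisj hAB)) (one_lt_aleph0.trans_le hk)))

theorem exists_fixing_selfmap_small_range (hk : k.IsRegular) (h2 : 2 ^< k ≤ k) {T : Type v}
    (hT : #T < k) {S : T → Type v} (hS : ∀ t, #(S t) ≤ k) {H : Type v} (hH : #H ≤ k)
    (φ : (∀ t, Function.End (S t)) →* Function.End H) (b : H) :
    ∃ g : ∀ t, Function.End (S t), φ g b = b ∧ #(Set.range (Sigma.map id g)) < k := by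
  choose s r hrs hsmall using fun t => exists_leftInverse_small_range hk.aleph0_le h2 (hS t)
  let σ (A : Set k.ord.ToType) : ∀ t, Function.End (S t) := fun t => s t A
  let ρ (A : Set k.ord.ToType) : ∀ t, Function.End (S t) := fun t => r t A
  have hρσ (A : Set k.ord.ToType) : ρ A * σ A = 1 := funext fun t => funext (hrs t A)
  obtain ⟨A, B, heq, hne⟩ : ∃ A B, φ (σ A) b = φ (σ B) b ∧ A ≠ B := by
    refine Function.not_injective_iff.1 fun hinj => (cantor k).not_ge ?_
    simpa only [mk_set, mk_ord_toType] using (mk_le_of_injective hinj).trans hH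
  refine ⟨ρ A * σ B, ?_, ?_⟩
  · calc φ (ρ A * σ B) b = φ (ρ A) (φ (σ B) b) := congrFun (map_mul φ _ _) b
      _ = φ (ρ A * σ A) b := heq ▸ (congrFun (map_mul φ _ _) b).symm
      _ = b := by rw [hρσ, map_one]; rfl
  · have hsub : Set.range (Sigma.map id (ρ A * σ B)) ⊆
        ⋃ t, Sigma.mk t '' Set.range (r t A ∘ s t B) := by
      rintro _ ⟨⟨t, x⟩, rfl⟩
      exact Set.mem_iUnion.2 ⟨t, _, ⟨x, rfl⟩, rfl⟩
    exact (mk_le_mk_of_subset hsub).trans_lt ((card_iUnion_lt_iff_forall_of_isRegular hk hT).2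
      fun t => mk_image_le.trans_lt (hsmall t hne))

theorem exists_small_closed (hk : k.IsRegular) (hunc : ℵ₀ < k) {I : Type v}
    (N : I → Set I) (hN : ∀ i, #(N i) < k) (R₀ : Set I) (hR₀ : #R₀ < k) :
    ∃ R : Set I, R₀ ⊆ R ∧ #R < k ∧ ∀ i ∈ R, N i ⊆ R := by
  let Q : ℕ → Set I := fun n => (fun A => ⋃ i ∈ A, N i)^[n] R₀
  have hQ_succ (n : ℕ) : Q (n + 1) = ⋃ i ∈ Q n, N i := Function.iterate_succ_apply' _ n R₀
  have hQ (n : ℕ) : #(Q n) < k := by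
    induction n with
    | zero => exact hR₀
    | succ n ih =>
      rw [hQ_succ, card_biUnion_lt_iff_forall_of_isRegular hk ih]
      exact fun i _ => hN i
  refine ⟨⋃ n : ULift.{v} ℕ, Q n.down,
    Set.subset_iUnion (fun n : ULift.{v} ℕ => Q n.down) ⟨0⟩, ?_, fun i hi => ?_⟩
  · exact (card_iUnion_lt_iff_forall_of_isRegular hk (by simpa using hunc)).2 fun n => hQ _
  · obtain ⟨n, hn⟩ := Set.mem_iUnion.1 hi
    have hsub : N i ⊆ Q (n.down + 1) := hQ_succ n.down ▸ Set.subset_biUnion_of_mem hn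
    exact hsub.trans (Set.subset_iUnion (fun n : ULift.{v} ℕ => Q n.down) ⟨n.down + 1⟩)

theorem exists_small_representatives {T J : Type v} (hT : #T < k) (τ : J → T) :
    ∃ R : Set J, #R < k ∧ ∀ j, ∃ i ∈ R, τ i = τ j :=
  ⟨Set.range (Set.rangeSplitting τ), mk_range_le.trans_lt ((mk_subtype_le _).trans_lt hT),
    fun j => ⟨_, ⟨⟨τ j, j, rfl⟩, rfl⟩, Set.apply_rangeSplitting τ ⟨τ j, j, rfl⟩⟩⟩

end Cardinals
section Coproducts

variable {D : Type u} [Category.{v} D] {J : Type*} {Y : J → D} {X : D} {inj : ∀ j, Y j ⟶ X}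

theorem inj_comp_desc (hX : IsColimit (Cofan.mk X inj)) {Z : D} (f : ∀ j, Y j ⟶ Z) (j : J) :
    inj j ≫ Cofan.IsColimit.desc hX f = f j :=
  Cofan.IsColimit.fac hX f j

theorem cofanMk_hom_ext (hX : IsColimit (Cofan.mk X inj)) {Z : D} {f g : X ⟶ Z}
    (h : ∀ j, inj j ≫ f = inj j ≫ g) : f = g :=
  Cofan.IsColimit.hom_ext hX f g h

theorem exists_retraction_of_subcoproduct (hX : IsColimit (Cofan.mk X inj)) (R : Set J) {Z : D}
    (z : ∀ j : R, Y j ⟶ Z) (hR : ∀ j, ∃ i ∈ R, Nonempty (Y j ⟶ Y i)) :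
    ∃ r : X ⟶ Z, ∀ j : R, inj j ≫ r = z j := by
  classical
  choose i hi f using hR
  refine ⟨Cofan.IsColimit.desc hX fun j =>
    if h : j ∈ R then z ⟨j, h⟩ else (f j).some ≫ z ⟨i j, hi j⟩, fun j => ?_⟩
  rw [inj_comp_desc hX, dif_pos j.2]

theorem isColimit_cofanMk_iso_comp (hX : IsColimit (Cofan.mk X inj)) {Y' : J → D}
    (e : ∀ j, Y' j ≅ Y j) : Nonempty (IsColimit (Cofan.mk X fun j => (e j).hom ≫ inj j)) := by
  refine ⟨Cofan.IsColimit.mk _ (fun s => Cofan.IsColimit.desc hX fun j => (e j).inv ≫ s.inj j)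
    (fun s j => ?_) fun s m hm => cofanMk_hom_ext hX fun j => ?_⟩
  · exact (Category.assoc _ _ _).trans (by rw [inj_comp_desc hX, Iso.hom_inv_id_assoc])
  · rw [inj_comp_desc hX, ← hm j]
    exact ((e j).inv_hom_id_assoc _).symm.trans (congrArg _ (Category.assoc _ _ _).symm)

theorem isColimit_subcoproduct (hX : IsColimit (Cofan.mk X inj)) (R : Set J)
    (hR : ∀ j, ∃ i ∈ R, ∃ f : Y j ⟶ Y i, f ≫ inj i = inj j) :
    Nonempty (IsColimit (Cofan.mk X fun j : R => inj j)) := by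
  choose desc hdesc using fun s : Cofan fun j : R => Y j =>
    exists_retraction_of_subcoproduct hX R s.inj fun j =>
      (hR j).imp fun _ hi => hi.imp_right fun ⟨f, _⟩ => ⟨f⟩
  refine ⟨Cofan.IsColimit.mk _ desc hdesc fun s m hm => cofanMk_hom_ext hX fun j => ?_⟩
  obtain ⟨i, hi, f, hf⟩ := hR j
  have hmi : inj i ≫ m = inj i ≫ desc s := (hm ⟨i, hi⟩).trans (hdesc s ⟨i, hi⟩).symm
  rw [← hf, Category.assoc, Category.assoc, hmi]

variable {T : Type*} {Cn : T → D} {S : T → Type*} {injS : ∀ p : Σ t, S t, Cn p.1 ⟶ X}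

/-- The action on a coproduct of the selfmaps of its index set that preserve the type `t` of each
summand `Cn t`. -/
noncomputable def reindexHom (hX : IsColimit (Cofan.mk X injS)) :
    (∀ t, Function.End (S t)) →* End X where
  toFun g := Cofan.IsColimit.desc hX fun p => injS ⟨p.1, g p.1 p.2⟩
  map_one' := cofanMk_hom_ext hX fun p =>
    (inj_comp_desc hX _ p).trans (Category.comp_id _).symm
  map_mul' g h := cofanMk_hom_ext hX fun p => by
    rw [End.mul_def, ← Category.assoc, inj_comp_desc hX, inj_comp_desc hX, inj_comp_desc hX]
    rfl

theorem inj_comp_reindexHom (hX : IsColimit (Cofan.mk X injS)) (g : ∀ t, Function.End (S t))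
    (p : Σ t, S t) : injS p ≫ reindexHom hX g = injS ⟨p.1, g p.1 p.2⟩ :=
  inj_comp_desc hX _ p

open Cardinal

theorem mk_hom_le_power {J : Type v} {Y : J → D} {inj : ∀ j, Y j ⟶ X}
    (hX : IsColimit (Cofan.mk X inj)) {Z : D} {c : Cardinal.{v}} (hc : ∀ j, #(Y j ⟶ Z) ≤ c) :
    #(X ⟶ Z) ≤ c ^ #J :=
  calc #(X ⟶ Z) ≤ #(∀ j, Y j ⟶ Z) := mk_le_of_injective (f := fun g j => inj j ≫ g)
        fun _ _ h => cofanMk_hom_ext hX (congrFun h)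
    _ = Cardinal.prod fun j => #(Y j ⟶ Z) := mk_pi _
    _ ≤ Cardinal.prod fun _ : J => c := prod_le_prod _ _ hc
    _ = c ^ #J := prod_const' J c

theorem exists_small_support {k : Cardinal.{v}} (hk : k.IsRegular) (h2 : 2 ^< k ≤ k)
    {T : Type v} (hT : #T < k) {Cn : T → D} {S : T → Type v} (hS : ∀ t, #(S t) ≤ k)
    {inj : ∀ p : Σ t, S t, Cn p.1 ⟶ X} (hX : IsColimit (Cofan.mk X inj))
    {E : Type*} [Category.{v} E] (G : D ⥤ E) {B : E} (hB : #(B ⟶ G.obj X) ≤ k)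
    (b : B ⟶ G.obj X) : ∃ R : Set (Σ t, S t), #R < k ∧ ∀ (Z : D) (m : Z ⟶ X),
      (∀ p ∈ R, ∃ z : Cn p.1 ⟶ Z, z ≫ m = inj p) → ∃ b' : B ⟶ G.obj Z, b' ≫ G.map m = b := by
  let φ : (∀ t, Function.End (S t)) →* Function.End (B ⟶ G.obj X) :=
    { toFun := fun g b => b ≫ G.map (reindexHom hX g)
      map_one' := funext fun b => by
        rw [map_one, End.one_def, G.map_id, Category.comp_id]; rfl
      map_mul' := fun g h => funext fun b => by
        rw [map_mul, End.mul_def, G.map_comp, ← Category.assoc]; rfl }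
  obtain ⟨g, hg, hsmall⟩ := exists_fixing_selfmap_small_range hk h2 hT hS hB φ b
  refine ⟨Set.range (Sigma.map id g), hsmall, fun Z m hm => ?_⟩
  have hm' (p : Σ t, S t) : ∃ z : Cn p.1 ⟶ Z, z ≫ m = inj ⟨p.1, g p.1 p.2⟩ := hm _ ⟨p, rfl⟩
  choose z hz using hm'
  refine ⟨b ≫ G.map (Cofan.IsColimit.desc hX z), ?_⟩
  have hfactor : Cofan.IsColimit.desc hX z ≫ m = reindexHom hX g :=
    cofanMk_hom_ext hX fun p => by
      rw [← Category.assoc, inj_comp_desc hX, hz, inj_comp_reindexHom]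
  rw [Category.assoc, ← G.map_comp, hfactor]
  exact hg

end Coproducts

section Generators

open Cardinal

variable {D : Type u} [Category.{v} D] {T : Type v}

/-- `X` is a coproduct of fewer than `k` objects of the family `Cn`. -/
def IsSmallCoproduct (Cn : T → D) (k : Cardinal.{v}) (X : D) : Prop :=
  ∃ (J : Type v) (τ : J → T) (inj : ∀ j, Cn (τ j) ⟶ X),
    #J < k ∧ Nonempty (IsColimit (Cofan.mk X inj))

/-- The morphism `q` exhibits `Q` as the coproduct of fewer than `k` of the summands of a
coproduct with injections `inj`. -/
def IsSmallSubcoproduct {J : Type v} {Y : J → D} {X : D} (inj : ∀ j, Y j ⟶ X)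
    (k : Cardinal.{v}) {Q : D} (q : Q ⟶ X) : Prop :=
  ∃ (R : Set J) (ι : ∀ j : R, Y j ⟶ Q),
    #R < k ∧ Nonempty (IsColimit (Cofan.mk Q ι)) ∧ ∀ j, ι j ≫ q = inj j

/-- The properties of `powerLE C k` that give terminal coalgebras: every object is a coproduct of
at most `k` objects from the family `Cn` of fewer than `k` objects, there are at most `k` morphisms
from each of these to any object, and colimits of size at most `k` exist. Such a coproduct is
indexed by a sigma type: `S t` is the set of summands `Cn t`. -/
structure IsGeneratedBy (Cn : T → D) (k : Cardinal.{v}) : Prop where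
  card_lt : #T < k
  exists_coproduct : ∀ X : D, ∃ (S : T → Type v) (inj : ∀ p : Σ t, S t, Cn p.1 ⟶ X),
    #(Σ t, S t) ≤ k ∧ Nonempty (IsColimit (Cofan.mk X inj))
  card_hom_le : ∀ t X, #(Cn t ⟶ X) ≤ k
  hasColimitsOfShape : ∀ (J : Type v) [SmallCategory J], #J ≤ k → HasColimitsOfShape J D

variable {Cn : T → D} {k : Cardinal.{v}}

theorem IsGeneratedBy.hasCoproduct (hD : IsGeneratedBy Cn k) {J : Type v} (hJ : #J ≤ k)
    (Y : J → D) : HasCoproduct Y := by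
  have := hD.hasColimitsOfShape (Discrete J) ((mk_congr discreteEquiv).trans_le hJ)
  exact inferInstanceAs (HasColimit (Discrete.functor Y))

theorem IsSmallSubcoproduct.isSmallCoproduct {J : Type v} {τ : J → T} {X Q : D}
    {inj : ∀ j, Cn (τ j) ⟶ X} {q : Q ⟶ X} (hq : IsSmallSubcoproduct inj k q) :
    IsSmallCoproduct Cn k Q :=
  let ⟨R, ι, hR, hQ, _⟩ := hq
  ⟨R, fun j => τ j, ι, hR, hQ⟩

theorem IsSmallSubcoproduct.hom_ext {J : Type v} {Y : J → D} {X Q : D} {inj : ∀ j, Y j ⟶ X}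
    {q : Q ⟶ X} (hq : IsSmallSubcoproduct inj k q) {Z : D} {f g : Q ⟶ Z}
    (h : ∀ j (y : Y j ⟶ Q), y ≫ q = inj j → y ≫ f = y ≫ g) : f = g := by
  obtain ⟨R, ι, -, ⟨hQ⟩, hι⟩ := hq
  exact cofanMk_hom_ext hQ fun j => h j (ι j) (hι j)

end Generators

section SmallCoalgebras

open Cardinal Endofunctor

variable {D : Type u} [Category.{v} D] {T : Type v} {Cn : T → D} {k : Cardinal.{v}}

theorem exists_supporting_subset (hk : k.IsRegular) (hunc : ℵ₀ < k) (h2 : 2 ^< k ≤ k)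
    (hD : IsGeneratedBy Cn k) {F : D ⥤ D} (A : Coalgebra F) {S : T → Type v}
    {inj : ∀ p : Σ t, S t, Cn p.1 ⟶ A.V} (hS : #(Σ t, S t) ≤ k)
    (hA : IsColimit (Cofan.mk A.V inj)) {I : Type v} (hI : #I < k) {σ : I → T}
    (b : ∀ i, Cn (σ i) ⟶ A.V) :
    ∃ R : Set (Σ t, S t), #R < k ∧ (∀ p : Σ t, S t, ∃ p' ∈ R, p'.1 = p.1) ∧
      ∀ (Z : D) (m : Z ⟶ A.V), (∀ p ∈ R, ∃ z : Cn p.1 ⟶ Z, z ≫ m = inj p) →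
        (∀ p ∈ R, ∃ c : Cn p.1 ⟶ F.obj Z, c ≫ F.map m = inj p ≫ A.str) ∧
          ∀ i, ∃ b' : Cn (σ i) ⟶ Z, b' ≫ m = b i := by
  have hfibre (t : T) : #(S t) ≤ k := (mk_le_of_injective sigma_mk_injective).trans hS
  choose N hN hNfac using fun p =>
    exists_small_support hk h2 hD.card_lt hfibre hA F (hD.card_hom_le p.1 _) (inj p ≫ A.str)
  choose M hM hMfac using fun i =>
    exists_small_support hk h2 hD.card_lt hfibre hA (𝟭 D) (hD.card_hom_le (σ i) _) (b i)
  obtain ⟨R₀, hR₀, hrep⟩ :=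
    exists_small_representatives hD.card_lt (Sigma.fst : (Σ t, S t) → T)
  have hM' : #(⋃ i, M i) < k := (card_iUnion_lt_iff_forall_of_isRegular hk hI).2 hM
  obtain ⟨R, hsub, hR, hclosed⟩ := exists_small_closed hk hunc N hN (R₀ ∪ ⋃ i, M i)
    ((mk_union_le _ _).trans_lt (add_lt_of_lt hk.aleph0_le hR₀ hM'))
  refine ⟨R, hR, fun p => ?_, fun Z m hm => ⟨fun p hp => ?_, fun i => ?_⟩⟩
  · obtain ⟨p', hp', heq⟩ := hrep p
    exact ⟨p', hsub (Or.inl hp'), heq⟩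
  · exact hNfac p Z m fun p' hp' => hm p' (hclosed p hp hp')
  · exact hMfac i Z m fun p hp => hm p (hsub (Or.inr (Set.mem_iUnion.2 ⟨i, hp⟩)))

/-- The coalgebras carried by a coproduct of fewer than `k` generators. -/
def smallCoalgebra (Cn : T → D) (k : Cardinal.{v}) (F : D ⥤ D) : ObjectProperty (Coalgebra F) :=
  fun Q => IsSmallCoproduct Cn k Q.V

theorem exists_small_subcoalgebra (hk : k.IsRegular) (hunc : ℵ₀ < k) (h2 : 2 ^< k ≤ k)
    (hD : IsGeneratedBy Cn k) {F : D ⥤ D} (A : Coalgebra F) {S : T → Type v}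
    {inj : ∀ p : Σ t, S t, Cn p.1 ⟶ A.V} (hS : #(Σ t, S t) ≤ k)
    (hA : IsColimit (Cofan.mk A.V inj)) {I : Type v} (hI : #I < k) {σ : I → T}
    (b : ∀ i, Cn (σ i) ⟶ A.V) :
    ∃ r : CostructuredArrow (smallCoalgebra Cn k F).ι A,
      IsSmallSubcoproduct inj k r.hom.f ∧ IsSplitMono r.hom.f ∧
        ∀ i, ∃ b' : Cn (σ i) ⟶ r.left.obj.V, b' ≫ r.hom.f = b i := by
  obtain ⟨R, hR, hrep, hfac⟩ := exists_supporting_subset hk hunc h2 hD A hS hA hI b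
  have := hD.hasCoproduct hR.le fun p : R => Cn p.1.1
  let ι : ∀ p : R, Cn p.1.1 ⟶ ∐ fun p : R => Cn p.1.1 := Sigma.ι fun p : R => Cn p.1.1
  have hι : IsColimit (Cofan.mk _ ι) := coproductIsCoproduct _
  let m : (∐ fun p : R => Cn p.1.1) ⟶ A.V := Cofan.IsColimit.desc hι fun p => inj p
  have ι_m (p : R) : ι p ≫ m = inj p := inj_comp_desc hι _ p
  obtain ⟨hstr, hb⟩ := hfac _ m fun p hp => ⟨ι ⟨p, hp⟩, ι_m _⟩
  choose c hc using fun p : R => hstr p p.2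
  obtain ⟨r, hr⟩ := exists_retraction_of_subcoproduct hA R ι fun p => by
    obtain ⟨p', hp', heq⟩ := hrep p
    exact ⟨p', hp', ⟨eqToHom (congrArg Cn heq.symm)⟩⟩
  have m_r : m ≫ r = 𝟙 _ := cofanMk_hom_ext hι fun p => by
    rw [← Category.assoc, ι_m, hr, Category.comp_id]
  have hm : Cofan.IsColimit.desc hι c ≫ F.map m = m ≫ A.str := cofanMk_hom_ext hι fun p => by
    rw [← Category.assoc, inj_comp_desc hι, hc, ← Category.assoc, ι_m]
  have hsub : IsSmallSubcoproduct inj k m := ⟨R, ι, hR, ⟨hι⟩, ι_m⟩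
  let Q : (smallCoalgebra Cn k F).FullSubcategory :=
    ⟨⟨_, Cofan.IsColimit.desc hι c⟩, hsub.isSmallCoproduct⟩
  exact ⟨CostructuredArrow.mk (Y := Q) ⟨m, hm⟩, hsub, ⟨⟨⟨r, m_r⟩⟩⟩, hb⟩

theorem exists_factor_of_isSplitMono {F : D ⥤ D} {Q P A : Coalgebra F} (q : Q ⟶ A)
    [IsSplitMono q.f] {I : Type*} {Y : I → D} {inj : ∀ i, Y i ⟶ P.V}
    (hP : IsColimit (Cofan.mk P.V inj)) (s : P ⟶ A)
    (h : ∀ i, ∃ y : Y i ⟶ Q.V, y ≫ q.f = inj i ≫ s.f) : ∃ u : P ⟶ Q, u ≫ q = s := by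
  choose y hy using h
  have hu : Cofan.IsColimit.desc hP y ≫ q.f = s.f := cofanMk_hom_ext hP fun i => by
    rw [← Category.assoc, inj_comp_desc hP, hy]
  refine ⟨⟨Cofan.IsColimit.desc hP y, ?_⟩, Coalgebra.ext hu⟩
  rw [← cancel_mono (F.map q.f), Category.assoc, ← F.map_comp, hu, Category.assoc, q.h, s.h,
    ← Category.assoc, hu]

theorem exists_split_small_subcoalgebra_over (hk : k.IsRegular) (hunc : ℵ₀ < k) (h2 : 2 ^< k ≤ k)
    (hD : IsGeneratedBy Cn k) {F : D ⥤ D} {A : Coalgebra F} {S : T → Type v}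
    {inj : ∀ p : Σ t, S t, Cn p.1 ⟶ A.V} (hS : #(Σ t, S t) ≤ k)
    (hA : IsColimit (Cofan.mk A.V inj)) (g g' : CostructuredArrow (smallCoalgebra Cn k F).ι A) :
    ∃ r : CostructuredArrow (smallCoalgebra Cn k F).ι A, IsSmallSubcoproduct inj k r.hom.f ∧
      IsSplitMono r.hom.f ∧ Nonempty (g ⟶ r) ∧ Nonempty (g' ⟶ r) := by
  obtain ⟨I, σ, i, hI, ⟨hi⟩⟩ := g.left.property
  obtain ⟨I', σ', i', hI', ⟨hi'⟩⟩ := g'.left.property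
  obtain ⟨r, hr, hmono, hfac⟩ := exists_small_subcoalgebra hk hunc h2 hD A hS hA
    (I := I ⊕ I') (by simpa using add_lt_of_lt hk.aleph0_le hI hI') (σ := Sum.elim σ σ')
    (Sum.rec (fun a => i a ≫ g.hom.f) (fun a => i' a ≫ g'.hom.f))
  obtain ⟨u, hu⟩ := exists_factor_of_isSplitMono r.hom hi g.hom fun a => hfac (Sum.inl a)
  obtain ⟨u', hu'⟩ := exists_factor_of_isSplitMono r.hom hi' g'.hom fun a => hfac (Sum.inr a)
  exact ⟨r, hr, hmono, ⟨CostructuredArrow.homMk (ObjectProperty.homMk u) hu⟩,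
    ⟨CostructuredArrow.homMk (ObjectProperty.homMk u') hu'⟩⟩

theorem exists_hom_from_small_eq (hk : k.IsRegular) (hunc : ℵ₀ < k) (h2 : 2 ^< k ≤ k)
    (hD : IsGeneratedBy Cn k) {F : D ⥤ D} (A : Coalgebra F) {t : T} (b : Cn t ⟶ A.V) :
    ∃ (g : CostructuredArrow (smallCoalgebra Cn k F).ι A) (x : Cn t ⟶ g.left.obj.V),
      x ≫ g.hom.f = b := by
  obtain ⟨S, inj, hS, ⟨hA⟩⟩ := hD.exists_coproduct A.V
  obtain ⟨g, -, -, hfac⟩ := exists_small_subcoalgebra hk hunc h2 hD A hS hA (I := PUnit)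
    (by simpa using one_lt_aleph0.trans hunc) (fun _ => b)
  exact ⟨g, hfac ⟨⟩⟩

theorem left_f_comp_hom_f {F : D ⥤ D} {A : Coalgebra F} {P : ObjectProperty (Coalgebra F)}
    {g g' : CostructuredArrow P.ι A} (u : g ⟶ g') : u.left.hom.f ≫ g'.hom.f = g.hom.f :=
  congrArg Coalgebra.Hom.f (CostructuredArrow.w u)

theorem comp_eq_of_comp_hom_eq (hk : k.IsRegular) (hunc : ℵ₀ < k) (h2 : 2 ^< k ≤ k)
    (hD : IsGeneratedBy Cn k) {F : D ⥤ D} {A : Coalgebra F} {Z : D}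
    {z : ∀ g : CostructuredArrow (smallCoalgebra Cn k F).ι A, g.left.obj.V ⟶ Z}
    (hz : ∀ {g g' : CostructuredArrow (smallCoalgebra Cn k F).ι A} (u : g ⟶ g'),
      u.left.hom.f ≫ z g' = z g)
    {g g' : CostructuredArrow (smallCoalgebra Cn k F).ι A} {B : D} {y : B ⟶ g.left.obj.V}
    {y' : B ⟶ g'.left.obj.V} (h : y ≫ g.hom.f = y' ≫ g'.hom.f) : y ≫ z g = y' ≫ z g' := by
  obtain ⟨S, inj, hS, ⟨hA⟩⟩ := hD.exists_coproduct A.V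
  obtain ⟨r, -, hmono, ⟨u⟩, ⟨u'⟩⟩ :=
    exists_split_small_subcoalgebra_over hk hunc h2 hD hS hA g g'
  have hmeet : y ≫ u.left.hom.f = y' ≫ u'.left.hom.f := by
    rw [← cancel_mono r.hom.f, Category.assoc, Category.assoc, left_f_comp_hom_f,
      left_f_comp_hom_f, h]
  rw [← hz u, ← hz u', ← Category.assoc, hmeet, Category.assoc]

theorem exists_hom_comp_eq (hk : k.IsRegular) (hunc : ℵ₀ < k) (h2 : 2 ^< k ≤ k)
    (hD : IsGeneratedBy Cn k) {F : D ⥤ D} {A Z : Coalgebra F}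
    (z : ∀ g : CostructuredArrow (smallCoalgebra Cn k F).ι A, g.left.obj ⟶ Z)
    (hz : ∀ {g g' : CostructuredArrow (smallCoalgebra Cn k F).ι A} (u : g ⟶ g'),
      u.left.hom ≫ z g' = z g) :
    ∃ h : A ⟶ Z, ∀ g : CostructuredArrow (smallCoalgebra Cn k F).ι A, g.hom ≫ h = z g := by
  have hz' {g g' : CostructuredArrow (smallCoalgebra Cn k F).ι A} (u : g ⟶ g') :
      u.left.hom.f ≫ (z g').f = (z g).f := congrArg Coalgebra.Hom.f (hz u)
  obtain ⟨S, inj, hS, ⟨hA⟩⟩ := hD.exists_coproduct A.V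
  choose P x hx using fun p => exists_hom_from_small_eq hk hunc h2 hD A (inj p)
  let h : A.V ⟶ Z.V := Cofan.IsColimit.desc hA fun p => x p ≫ (z (P p)).f
  have inj_h (p) : inj p ≫ h = x p ≫ (z (P p)).f := inj_comp_desc hA _ p
  have hom_h (g : CostructuredArrow (smallCoalgebra Cn k F).ι A) : g.hom.f ≫ h = (z g).f := by
    obtain ⟨r, hr, -, ⟨u⟩, -⟩ := exists_split_small_subcoalgebra_over hk hunc h2 hD hS hA g g
    have hrh : r.hom.f ≫ h = (z r).f := hr.hom_ext fun p y hy => by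
      rw [← Category.assoc, hy, inj_h]
      exact comp_eq_of_comp_hom_eq hk hunc h2 hD hz' ((hx p).trans hy.symm)
    rw [← left_f_comp_hom_f u, Category.assoc, hrh, hz']
  refine ⟨⟨h, cofanMk_hom_ext hA fun p => ?_⟩, fun g => Coalgebra.ext (hom_h g)⟩
  calc inj p ≫ A.str ≫ F.map h = x p ≫ (P p).hom.f ≫ A.str ≫ F.map h := by
        rw [← hx p, Category.assoc]
    _ = x p ≫ (P p).left.obj.str ≫ F.map ((P p).hom.f ≫ h) := by
        rw [F.map_comp, Coalgebra.Hom.h_assoc]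
    _ = x p ≫ (z (P p)).f ≫ Z.str := by rw [hom_h, Coalgebra.Hom.h]
    _ = inj p ≫ h ≫ Z.str := by rw [← Category.assoc, ← inj_h, Category.assoc]

theorem hom_ext_of_small (hk : k.IsRegular) (hunc : ℵ₀ < k) (h2 : 2 ^< k ≤ k)
    (hD : IsGeneratedBy Cn k) {F : D ⥤ D} {A Z : Coalgebra F} {h h' : A ⟶ Z}
    (H : ∀ g : CostructuredArrow (smallCoalgebra Cn k F).ι A, g.hom ≫ h = g.hom ≫ h') :
    h = h' := by
  obtain ⟨S, inj, -, ⟨hA⟩⟩ := hD.exists_coproduct A.V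
  refine Coalgebra.ext (cofanMk_hom_ext hA fun p => ?_)
  obtain ⟨g, x, hx⟩ := exists_hom_from_small_eq hk hunc h2 hD A (inj p)
  have hg : g.hom.f ≫ h.f = g.hom.f ≫ h'.f := congrArg Coalgebra.Hom.f (H g)
  rw [← hx, Category.assoc, Category.assoc, hg]

theorem isDense_smallCoalgebra (hk : k.IsRegular) (hunc : ℵ₀ < k) (h2 : 2 ^< k ≤ k)
    (hD : IsGeneratedBy Cn k) (F : D ⥤ D) : (smallCoalgebra Cn k F).ι.IsDense where
  isDenseAt A := by
    let c := (Functor.LeftExtension.mk (𝟭 _) (smallCoalgebra Cn k F).ι.rightUnitor.inv).coconeAt A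
    have app_eq (g : CostructuredArrow (smallCoalgebra Cn k F).ι A) : c.ι.app g = g.hom :=
      Category.id_comp g.hom
    choose h hh using fun s : Cocone (CostructuredArrow.proj (smallCoalgebra Cn k F).ι A ⋙
      (smallCoalgebra Cn k F).ι) =>
      exists_hom_comp_eq hk hunc h2 hD (fun g => s.ι.app g) (fun u => s.w u)
    refine ⟨({ desc := h, fac := fun s g => ?_, uniq := fun s m hm => ?_ } : IsColimit c)⟩
    · exact (congrArg (· ≫ h s) (app_eq g)).trans (hh s g)
    · refine hom_ext_of_small hk hunc h2 hD fun g => ?_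
      exact (congrArg (· ≫ m) (app_eq g)).symm.trans ((hm g).trans (hh s g).symm)

end SmallCoalgebras

section TerminalCoalgebra

open Cardinal Endofunctor

variable {D : Type u} [Category.{v} D]

theorem hasTerminal_of_isDense {E : Type*} [Category* E] (G : E ⥤ D) [G.IsDense]
    [HasColimit G] : HasTerminal D := by
  let c : Cocone (𝟭 D) := (𝟭 D).coconeOfIsLeftKanExtension G.rightUnitor.inv (colimit.cocone G)
  have hc : IsColimit c :=
    (𝟭 D).isColimitCoconeOfIsLeftKanExtension G.rightUnitor.inv (colimit.isColimit G)
  let leg (A : D) : A ⟶ c.pt := c.ι.app A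
  have leg_naturality {A B : D} (f : A ⟶ B) : f ≫ leg B = leg A := c.w f
  have leg_pt : leg c.pt = 𝟙 c.pt := hc.hom_ext fun A =>
    (leg_naturality (leg A)).trans (Category.comp_id _).symm
  refine IsTerminal.hasTerminal (X := c.pt) (IsTerminal.ofUniqueHom leg fun A f => ?_)
  rw [← leg_naturality f, leg_pt, Category.comp_id]

theorem hasColimit_coalgebra {F : D ⥤ D} {J : Type*} [Category* J] (K : J ⥤ Coalgebra F)
    [HasColimit (K ⋙ Coalgebra.forget F)] : HasColimit K := by
  let ι (j : J) : (K.obj j).V ⟶ colimit (K ⋙ Coalgebra.forget F) :=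
    colimit.ι (K ⋙ Coalgebra.forget F) j
  have ι_w {i j : J} (f : i ⟶ j) : (K.map f).f ≫ ι j = ι i :=
    colimit.w (K ⋙ Coalgebra.forget F) f
  let strCocone : Cocone (K ⋙ Coalgebra.forget F) :=
    { pt := F.obj (colimit (K ⋙ Coalgebra.forget F))
      ι :=
        { app := fun j => (K.obj j).str ≫ F.map (ι j)
          naturality := fun i j f => by
            change (K.map f).f ≫ (K.obj j).str ≫ F.map (ι j) = ((K.obj i).str ≫ F.map (ι i)) ≫ 𝟙 _
            rw [Category.comp_id, ← ι_w f, F.map_comp, Coalgebra.Hom.h_assoc] } }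
  have ι_str (j : J) : ι j ≫ colimit.desc _ strCocone = (K.obj j).str ≫ F.map (ι j) :=
    colimit.ι_desc strCocone j
  let c : Cocone K :=
    { pt := ⟨_, colimit.desc _ strCocone⟩
      ι :=
        { app := fun j => ⟨ι j, (ι_str j).symm⟩
          naturality := fun i j f => Coalgebra.ext ((ι_w f).trans (Category.comp_id _).symm) } }
  have hc : IsColimit ((Coalgebra.forget F).mapCocone c) :=
    colimit.isColimit (K ⋙ Coalgebra.forget F)
  let desc (s : Cocone K) : colimit (K ⋙ Coalgebra.forget F) ⟶ s.pt.V :=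
    hc.desc ((Coalgebra.forget F).mapCocone s)
  have ι_desc (s : Cocone K) (j : J) : ι j ≫ desc s = (s.ι.app j).f := hc.fac _ j
  have hdesc (s : Cocone K) :
      colimit.desc _ strCocone ≫ F.map (desc s) = desc s ≫ s.pt.str :=
    hc.hom_ext fun j => by
      change ι j ≫ colimit.desc _ strCocone ≫ F.map (desc s) = ι j ≫ desc s ≫ s.pt.str
      rw [← Category.assoc, ι_str, Category.assoc, ← F.map_comp, ← Category.assoc, ι_desc]
      exact (s.ι.app j).h
  exact ⟨⟨⟨c, IsColimit.ofFaithful (Coalgebra.forget F) hc (fun s => ⟨desc s, hdesc s⟩)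
    fun s => rfl⟩⟩⟩

variable {k : Cardinal.{v}}

theorem exists_equiv_Iio {J : Type v} (hJ : #J < k) :
    ∃ i : k.ord.ToType, Nonempty (Set.Iio i ≃ J) := by
  obtain ⟨i, hi⟩ := Ordinal.typein_surj (· < · : k.ord.ToType → k.ord.ToType → Prop)
    (o := (#J).ord) (by simpa only [Ordinal.type_toType] using ord_lt_ord.2 hJ)
  have hcard : #(Set.Iio i) = #J := by
    have h := Ordinal.card_typein (r := (· < · : k.ord.ToType → k.ord.ToType → Prop)) i
    rw [hi, card_ord] at h
    exact h.symm
  exact ⟨i, Cardinal.eq.1 hcard⟩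

theorem hasColimitsOfShape_of_representatives
    (hD : ∀ (J : Type v) [SmallCategory J], #J ≤ k → HasColimitsOfShape J D)
    {E : Type*} [Category.{v} E] {Θ : Type v} (hΘ : #Θ ≤ k) (Q : Θ → E)
    (hQ : ∀ P, ∃ θ, Nonempty (Q θ ≅ P)) : HasColimitsOfShape E D := by
  have := hD (InducedCategory E Q) hΘ
  have : (inducedFunctor Q).EssSurj := ⟨hQ⟩
  have : (inducedFunctor Q).IsEquivalence := { }
  exact hasColimitsOfShape_of_equivalence (inducedFunctor Q).asEquivalence

variable {T : Type v} {Cn : T → D}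

theorem exists_small_coalgebra_representatives (hk : k.IsRegular) (h2 : 2 ^< k ≤ k)
    (hD : IsGeneratedBy Cn k) (F : D ⥤ D) :
    ∃ (Θ : Type v) (Q : Θ → (smallCoalgebra Cn k F).FullSubcategory), #Θ ≤ k ∧
      ∀ P, ∃ θ, Nonempty (Q θ ≅ P) := by
  have hpow (i : k.ord.ToType) : k ^ #(Set.Iio i) ≤ k :=
    power_le_self_of_lt_cof hk.aleph0_le h2 ((mk_Iio_ord_lt i).trans_eq hk.cof_ord.symm)
  have hcop (i : k.ord.ToType) (τ : Set.Iio i → T) : HasCoproduct fun x => Cn (τ x) :=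
    hD.hasCoproduct (mk_Iio_ord_lt i).le _
  let Q (θ : Σ (i : k.ord.ToType) (τ : Set.Iio i → T),
      (∐ fun x => Cn (τ x)) ⟶ F.obj (∐ fun x => Cn (τ x))) :
      (smallCoalgebra Cn k F).FullSubcategory :=
    ⟨⟨_, θ.2.2⟩, _, θ.2.1, _, mk_Iio_ord_lt θ.1, ⟨coproductIsCoproduct _⟩⟩
  refine ⟨_, Q, ?_, ?_⟩
  · refine mk_sigma_le hk.aleph0_le (mk_ord_toType k).le fun i => ?_
    refine mk_sigma_le hk.aleph0_le ?_ fun τ =>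
      (mk_hom_le_power (coproductIsCoproduct fun x => Cn (τ x)) fun _ =>
        hD.card_hom_le _ _).trans (hpow i)
    exact (power_def _ _).trans_le ((power_le_power_right hD.card_lt.le).trans (hpow i))
  · rintro ⟨⟨V, a⟩, J, τ, inj, hJ, ⟨hV⟩⟩
    obtain ⟨i, ⟨e⟩⟩ := exists_equiv_Iio hJ
    have hV' : IsColimit (Cofan.mk V fun x => inj (e x)) := Cofan.isColimitEquivOfEquiv e _ hV
    let φ : (∐ fun x => Cn (τ (e x))) ≅ V :=
      (coproductIsCoproduct fun x => Cn (τ (e x))).coconePointUniqueUpToIso hV'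
    let θ : (∐ fun x => Cn (τ (e x))) ⟶ F.obj (∐ fun x => Cn (τ (e x))) :=
      φ.hom ≫ a ≫ F.map φ.inv
    exact ⟨⟨i, τ ∘ e, θ⟩, ⟨ObjectProperty.isoMk _ (Coalgebra.isoMk φ (by simp [Q, θ]))⟩⟩

theorem hasTerminal_coalgebra (hk : k.IsRegular) (hunc : ℵ₀ < k) (h2 : 2 ^< k ≤ k)
    (hD : IsGeneratedBy Cn k) (F : D ⥤ D) : HasTerminal (Coalgebra F) := by
  obtain ⟨Θ, Q, hΘ, hQ⟩ := exists_small_coalgebra_representatives hk h2 hD F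
  have := hasColimitsOfShape_of_representatives hD.hasColimitsOfShape hΘ Q hQ
  have := hasColimit_coalgebra (smallCoalgebra Cn k F).ι
  have := isDense_smallCoalgebra hk hunc h2 hD F
  exact hasTerminal_of_isDense (smallCoalgebra Cn k F).ι

end TerminalCoalgebra

section PowerBounds

open Cardinal

variable {C : Type u} [Category.{v} C] {w k : Cardinal.{v}}

theorem exists_connected_representatives (hw : IsWidthBound C w) :
    ∃ (T : Type v) (Cn : T → C), #T ≤ w ∧ (∀ t, IsConnectedObject (Cn t)) ∧
      ∀ X, IsConnectedObject X → ∃ t, Nonempty (Cn t ≅ X) := by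
  have h : lift.{v} #(connectedClasses C) ≤ lift.{u} #w.out := by simpa only [mk_out] using hw.1
  obtain ⟨emb⟩ := lift_mk_le'.1 h
  let e := Equiv.ofInjective emb emb.injective
  choose Cn hCn hcls using fun c : connectedClasses C => c.2
  refine ⟨Set.range emb, fun t => Cn (e.symm t), (mk_subtype_le _).trans_eq w.mk_out,
    fun t => hCn _, fun X hX => ?_⟩
  let c : connectedClasses C := ⟨_, X, hX, rfl⟩
  have hc : Quotient.mk (isIsomorphicSetoid C) (Cn (e.symm (e c))) = Quotient.mk _ X := by
    rw [hcls, e.symm_apply_apply]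
  exact ⟨e c, Quotient.exact hc⟩

theorem powerLE_of_isConnectedObject (hk : 1 ≤ k) {X : C} (hX : IsConnectedObject X) :
    powerLE C k X :=
  ⟨1, hk, PUnit, fun _ => X, fun _ => 𝟙 X, mk_punit, fun _ => hX,
    ⟨Cofan.isColimitMkOfUnique (Iso.refl X) PUnit⟩⟩

theorem powerLE_coproduct (hk : ℵ₀ ≤ k) {I : Type v} (hI : #I ≤ k) {X : I → C} {Z : C}
    {inj : ∀ i, X i ⟶ Z} (hZ : IsColimit (Cofan.mk Z inj)) (hX : ∀ i, powerLE C k (X i)) :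
    powerLE C k Z := by
  choose α hα J Y ι hJ hY hι using hX
  exact ⟨_, mk_sigma_le hk hI fun i => (hJ i).trans_le (hα i), Σ i, J i, fun p => Y p.1 p.2,
    fun p => ι p.1 p.2 ≫ inj p.1, rfl, fun p => hY _ _,
    ⟨Cofan.isColimitTrans _ hZ _ fun i => (hι i).some⟩⟩

theorem exists_sigma_coproduct {T : Type v} {Cn : T → C}
    (hrep : ∀ X, IsConnectedObject X → ∃ t, Nonempty (Cn t ≅ X)) {X : C} (hX : powerLE C k X) :
    ∃ (S : T → Type v) (inj : ∀ p : Σ t, S t, Cn p.1 ⟶ X),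
      #(Σ t, S t) ≤ k ∧ Nonempty (IsColimit (Cofan.mk X inj)) := by
  obtain ⟨α, hα, J, Y, inj, hJ, hY, ⟨hX⟩⟩ := hX
  choose τ e using fun j => hrep (Y j) (hY j)
  let ε : (Σ t, {j // τ j = t}) ≃ J := Equiv.sigmaFiberEquiv τ
  have hX' : IsColimit (Cofan.mk X fun p => inj (ε p)) := Cofan.isColimitEquivOfEquiv ε _ hX
  exact ⟨_, _, (mk_congr ε).trans_le (hJ.trans_le hα), isColimit_cofanMk_iso_comp hX' fun p =>
    eqToIso (congrArg Cn p.2.2.symm) ≪≫ (e (ε p)).some⟩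

theorem mk_hom_le_of_powerLE [HasCoproducts.{v} C] (hw : IsWidthBound C w) (hk : ℵ₀ ≤ k)
    (hwk : w ≤ k) {B X : C} (hB : IsConnectedObject B) (hX : powerLE C k X) : #(B ⟶ X) ≤ k := by
  rcases isEmpty_or_nonempty (B ⟶ X) with hempty | ⟨⟨f⟩⟩
  · exact (mk_eq_zero (B ⟶ X)).trans_le zero_le
  obtain ⟨α, hα, J, Y, inj, hJ, hY, ⟨hX⟩⟩ := hX
  -- The width bound does not cover objects of power less than `w`. Padding `X` with `k` copies of
  -- `B` gives an object of power `k`, of which `X` is a retract since there is a map `B ⟶ X`.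
  let Y' : J ⊕ k.out → C := Sum.elim Y fun _ => B
  have hpow : HasPower (∐ Y') k :=
    ⟨J ⊕ k.out, Y', Sigma.ι Y', by rw [mk_sum, lift_id, lift_id, mk_out, hJ, add_eq_right hk hα],
      Sum.rec hY fun _ => hB, ⟨coproductIsCoproduct Y'⟩⟩
  let ι (j : J) : Y j ⟶ ∐ Y' := Sigma.ι Y' (Sum.inl j)
  let m : X ⟶ ∐ Y' := Cofan.IsColimit.desc hX ι
  let r : (∐ Y') ⟶ X := Sigma.desc (Sum.rec inj fun _ => f)
  have inj_m (j : J) : inj j ≫ m = ι j := inj_comp_desc hX ι j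
  have ι_r (j : J) : ι j ≫ r = inj j := Sigma.ι_desc (f := Y') _ (Sum.inl j)
  have m_r : m ≫ r = 𝟙 X := cofanMk_hom_ext hX fun j => by
    rw [← Category.assoc, inj_m, ι_r, Category.comp_id]
  have : IsSplitMono m := ⟨⟨⟨r, m_r⟩⟩⟩
  exact (mk_le_of_injective fun g g' h => (cancel_mono m).1 h).trans (hw.2 k hwk B _ hB hpow)

theorem injective_copies_of_nontrivial {J M : Type*} {Y : J → C} {X N : C}
    (inj : ∀ j, Y j ⟶ X) {ι : ∀ p : J × M, Y p.1 ⟶ N} (hN : IsColimit (Cofan.mk N ι)) {j : J}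
    (hj : Nontrivial (Y j ⟶ X)) :
    Function.Injective (β := Y j ⟶ N) fun a : M => ι (j, a) := by
  classical
  intro a b hab
  by_contra hne
  have eq_inj (f : Y j ⟶ X) : f = inj j := by
    let F : ∀ p : J × M, Y p.1 ⟶ X := Function.update (fun p => inj p.1) (j, a) f
    calc f = F (j, a) := by simp only [F, Function.update_self]
      _ = ι (j, a) ≫ Cofan.IsColimit.desc hN F := (inj_comp_desc hN F (j, a)).symm
      _ = ι (j, b) ≫ Cofan.IsColimit.desc hN F := congrArg (· ≫ _) hab
      _ = F (j, b) := inj_comp_desc hN F (j, b)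
      _ = inj j := Function.update_of_ne (fun h => hne (congrArg Prod.snd h).symm) _ _
  exact not_subsingleton (Y j ⟶ X) ⟨fun f g => (eq_inj f).trans (eq_inj g).symm⟩

theorem power_mk_nontrivial_summands_le_mk_hom {J M : Type v} [Nonempty M] {Y : J → C} {X N : C}
    {inj : ∀ j, Y j ⟶ X} (hX : IsColimit (Cofan.mk X inj)) {ι : ∀ p : J × M, Y p.1 ⟶ N}
    (hN : IsColimit (Cofan.mk N ι)) : #M ^ #{j | Nontrivial (Y j ⟶ X)} ≤ #(X ⟶ N) := by
  let P : Set J := {j | Nontrivial (Y j ⟶ X)}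
  let extend (g : P → M) : J → M := Function.extend Subtype.val g fun _ => Classical.arbitrary M
  have extend_apply (g : P → M) (j : P) : extend g j = g j :=
    Subtype.val_injective.extend_apply g _ j
  rw [power_def]
  refine mk_le_of_injective
    (f := fun g : P → M => Cofan.IsColimit.desc hX fun j => ι (j, extend g j)) fun g g' h => ?_
  funext j
  have hj : ι (j, extend g j) = ι (j, extend g' j) := by
    have := congrArg (inj j ≫ ·) h
    simpa only [inj_comp_desc] using this
  rw [← extend_apply g, ← extend_apply g']
  exact injective_copies_of_nontrivial inj hN j.2 hj

theorem mk_nontrivial_summands_le [HasCoproducts.{v} C] (hw : IsWidthBound C w) (hk : ℵ₀ ≤ k)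
    (hwk : w ≤ k) {X Y : C} (hX : powerLE C k X) (e : X ⟶ Y) [Epi e] {J : Type v} {Z : J → C}
    (hZ : ∀ j, IsConnectedObject (Z j)) {inj : ∀ j, Z j ⟶ Y} (hY : IsColimit (Cofan.mk Y inj)) :
    #{j | Nontrivial (Z j ⟶ Y)} ≤ k := by
  by_contra! hP
  obtain ⟨α, hα, I, B, injX, hI, hB, ⟨hX⟩⟩ := hX
  obtain ⟨μ, hJμ, hkμ, hμ, hμ_lt⟩ := exists_ge_power_le_self_lt_power_succ hk #J
  have hJ : #J ≠ 0 := fun h => (hP.trans_le (mk_set_le _)).ne_bot h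
  have hμ0 : μ ≠ 0 := (aleph0_pos.trans_le (hk.trans hkμ)).ne'
  have : Nonempty μ.out := mk_ne_zero_iff.1 (μ.mk_out.trans_ne hμ0)
  let N : C := ∐ fun p : J × μ.out => Z p.1
  have hN : HasPower N μ :=
    ⟨J × μ.out, fun p => Z p.1, Sigma.ι _,
      by rw [mk_prod, lift_id, lift_id, mk_out, mul_eq_right (hk.trans hkμ) hJμ hJ],
      fun p => hZ p.1, ⟨coproductIsCoproduct _⟩⟩
  refine hμ_lt.not_ge ?_
  calc μ ^ Order.succ k ≤ μ ^ #{j | Nontrivial (Z j ⟶ Y)} :=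
        power_le_power_left hμ0 (Order.succ_le_of_lt hP)
    _ ≤ #(Y ⟶ N) := by
        simpa only [mk_out] using power_mk_nontrivial_summands_le_mk_hom (M := μ.out) hY
          (coproductIsCoproduct fun p : J × μ.out => Z p.1)
    _ ≤ #(X ⟶ N) := mk_le_of_injective (f := (e ≫ ·)) fun _ _ => (cancel_epi e).1
    _ ≤ μ ^ #I := mk_hom_le_power hX fun i => hw.2 μ (hwk.trans hkμ) _ _ (hB i) hN
    _ ≤ μ ^ k := power_le_power_left hμ0 (hI.trans_le hα)
    _ ≤ μ := hμ

theorem powerLE_of_epi [HasCoproducts.{v} C] (hw : IsWidthBound C w) (hk : ℵ₀ ≤ k) (hwk : w < k)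
    {X Y : C} (hX : powerLE C k X) (e : X ⟶ Y) [Epi e] (hY : ∃ α, HasPower Y α) :
    powerLE C k Y := by
  obtain ⟨-, J, Z, inj, -, hZ, ⟨hY⟩⟩ := hY
  obtain ⟨T, Cn, hT, -, hrep⟩ := exists_connected_representatives hw
  choose τ φ using fun j => hrep (Z j) (hZ j)
  obtain ⟨R, hR, hRrep⟩ := exists_small_representatives (hT.trans_lt hwk) τ
  let P : Set J := {j | Nontrivial (Z j ⟶ Y)}
  have hP : #P ≤ k := mk_nontrivial_summands_le hw hk hwk.le hX e hZ hY
  refine ⟨_, (mk_union_le P R).trans (add_le_of_le hk hP hR.le), (P ∪ R : Set J), fun j => Z j,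
    fun j => inj j, rfl, fun j => hZ j, isColimit_subcoproduct hY _ fun j => ?_⟩
  by_cases hj : Nontrivial (Z j ⟶ Y)
  · exact ⟨j, Or.inl hj, 𝟙 _, Category.id_comp _⟩
  · obtain ⟨i, hi, hij⟩ := hRrep j
    have := not_nontrivial_iff_subsingleton.1 hj
    exact ⟨i, Or.inr hi, (φ j).some.inv ≫ eqToHom (congrArg Cn hij.symm) ≫ (φ i).some.hom,
      Subsingleton.elim _ _⟩

theorem isClosedUnderColimitsOfShape_powerLE [HasCoproducts.{v} C] (hw : HasWidth C w)
    (hk : ℵ₀ ≤ k) (hwk : w < k) (J : Type v) [SmallCategory J] (hJ : #J ≤ k) :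
    (powerLE C k).IsClosedUnderColimitsOfShape J := by
  refine ⟨?_⟩
  rintro X ⟨P⟩
  let q : (∐ P.diag.obj) ⟶ X := Sigma.desc P.ι.app
  have : Epi q := ⟨fun g h hgh => P.isColimit.hom_ext fun j => by
    simpa [q] using congrArg (Sigma.ι P.diag.obj j ≫ ·) hgh⟩
  exact powerLE_of_epi hw.2.2.1 hk hwk
    (powerLE_coproduct hk hJ (coproductIsCoproduct P.diag.obj) P.prop_diag_obj) q (hw.2.1 X)

theorem isGeneratedBy_powerLE [HasColimits C] (hw : HasWidth C w) (hk : ℵ₀ ≤ k) (hwk : w < k) :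
    ∃ (T : Type v) (Cn : T → (powerLE C k).FullSubcategory), IsGeneratedBy Cn k := by
  obtain ⟨T, Cn, hT, hCn, hrep⟩ := exists_connected_representatives hw.2.2.1
  refine ⟨T, fun t => ⟨Cn t, powerLE_of_isConnectedObject (one_le_aleph0.trans hk) (hCn t)⟩,
    hT.trans_lt hwk, fun X => ?_, fun t X => ?_, fun J _ hJ => ?_⟩
  · obtain ⟨S, inj, hS, ⟨hX⟩⟩ := exists_sigma_coproduct hrep X.property
    exact ⟨S, fun p => ObjectProperty.homMk (inj p), hS,
      ⟨Cofan.IsColimit.mk _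
        (fun s => ObjectProperty.homMk (Cofan.IsColimit.desc hX fun p => (s.inj p).hom))
        (fun s p => ObjectProperty.hom_ext _ (inj_comp_desc hX _ p)) fun s m hm =>
          ObjectProperty.hom_ext _ (cofanMk_hom_ext hX fun p =>
            (congrArg (·.hom) (hm p)).trans (inj_comp_desc hX (fun p => (s.inj p).hom) p).symm)⟩⟩
  · exact (mk_le_of_injective fun f g h => ObjectProperty.hom_ext _ h :
      #(_ ⟶ X) ≤ #(Cn t ⟶ X.obj)).trans
      (mk_hom_le_of_powerLE hw.2.2.1 hk hwk.le (hCn t) X.property)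
  · have := isClosedUnderColimitsOfShape_powerLE hw hk hwk J hJ
    infer_instance

end PowerBounds

end AlgebraicallyCocomplete

theorem GCH.two_powerlt_le (gch : GCH.{v}) {k : Cardinal.{v}} (hk : Cardinal.aleph0 ≤ k) :
    Cardinal.powerlt 2 k ≤ k :=
  Cardinal.powerlt_le.2 fun c hc => by
    rcases lt_or_ge c Cardinal.aleph0 with hfin | hinf
    · exact (Cardinal.power_lt_aleph0 (Cardinal.natCast_lt_aleph0 (n := 2)) hfin).le.trans hk
    · exact gch c hinf ▸ Order.succ_le_of_lt hc

theorem theoremT_general (C : Type u) [Category.{v} C] [HasColimits C] {w : Cardinal.{v}}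
    (hw : HasWidth C w) {k : Cardinal.{v}} (hk : k.IsRegular) (hk_unc : Cardinal.aleph0 < k)
    (hk_pow : Cardinal.powerlt 2 k ≤ k) (hwk : w < k) :
    AlgebraicallyCocomplete (powerLE C k).FullSubcategory := by
  intro F
  obtain ⟨T, Cn, hCn⟩ := AlgebraicallyCocomplete.isGeneratedBy_powerLE hw hk.aleph0_le hwk
  exact AlgebraicallyCocomplete.hasTerminal_coalgebra hk hk_unc hk_pow hCn F

theorem theoremT (gch : GCH.{v}) (C : Type u) [Category.{v} C] [HasColimits C]
    (hC : IsCowellPowered C) (w : Cardinal.{v}) (hw : HasWidth C w)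
    (k : Cardinal.{v}) (hk : k.IsRegular) (hk_unc : Cardinal.aleph0 < k) (hwk : w < k) :
    AlgebraicallyCocomplete (powerLE C k).FullSubcategory :=
  theoremT_general C hw hk hk_unc (gch.two_powerlt_le hk.aleph0_le) hwk
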